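/- Let $N\ge 3$ and let $\Omega\subset\mathbb R^N$ be a bounded domain (non-empty, open, connected) with $C^2$-boundary. Let $G(x,y)$ be the Green's function of $-\Delta$ on $\Omega$ under Dirichlet boundary conditions, let $\sigma_N$ be the surface measure of the unit sphere in $\mathbb R^N$, and let $$H(x,y)=\frac{1}{(N-2)\sigma_N|x-y|^{N-2}}-G(x,y)$$ be the regular part of $G$ (extended by continuity to $y=x$); so for each $x\in\Omega$ the function $H(x,\cdot)$ is continuous on $\overline\Omega$, harmonic in $\Omega$, and equal to $\frac{1}{(N-2)\sigma_N|x-y|^{N-2}}$ for $y\in\partial\Omega$. Write $\mathrm d(x)=\operatorname{dist}(x,\partial\Omega)$. Then there are constants $\delta>0$ and $C>0$, depending only on $\Omega$, with the following properties. Every $x\in\Omega_0:=\{x\in\Omega:\mathrm d(x)<\delta\}$ has a unique nearest point $p(x)$ on $\partial\Omega$, and its reflection $\bar x=2p(x)-x$ does not lie in $\Omega$. Let $\nu_x=\frac{x-p(x)}{|x-p(x)|}$ denote the inward unit normal at $p(x)$, and let $\frac{\partial}{\partial\nu_x}$ be the derivative with respect to $x$ in the direction $\nu_x$. Then for all $x\in\Omega_0$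 and all $y\in\Omega$, $$\left|H(x,y)-\frac{1}{(N-2)\sigma_N|\bar x-y|^{N-2}}\right|\le \frac{C\,\mathrm d(x)}{|\bar x-y|^{N-2}},$$ the derivatives $\frac{\partial H}{\partial\nu_x}(x,y)$ and $\frac{\partial}{\partial\nu_x}\left(\frac{1}{|\bar x-y|^{N-2}}\right)$ exist, and $$\left|\frac{\partial H}{\partial \nu_x}(x,y)-\frac{1}{(N-2)\sigma_N}\frac{\partial}{\partial\nu_x}\left(\frac{1}{|\bar x-y|^{N-2}}\right)\right|\le \frac{C}{|\bar x-y|^{N-2}}.$$ -/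

import Mathlib

open Set Filter Topology MeasureTheory InnerProductSpace

noncomputable section

/-- The boundary of `Ω` is of class `C²`: near each boundary point, in suitable Cartesian
coordinates (the last axis pointing in the unit direction `e`), `Ω` is the set of points lying
strictly above the graph of a `C²` function `ρ`. The point `z - ⟪e, z⟫ • e` is the orthogonal
projection of `z` to the hyperplane through `0` normal to `e`, so only the values of `ρ` on that
hyperplane matter. -/
def HasC2Boundary {N : ℕ} (Ω : Set (EuclideanSpace ℝ (Fin N))) : Prop :=
  ∀ p ∈ frontier Ω, ∃ e : EuclideanSpace ℝ (Fin N), ‖e‖ = 1 ∧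
    ∃ ρ : EuclideanSpace ℝ (Fin N) → ℝ, ContDiff ℝ 2 ρ ∧
      ∀ᶠ z in 𝓝 p, (z ∈ Ω ↔ ρ (z - (inner ℝ e z : ℝ) • e) < (inner ℝ e z : ℝ))

/-- `σ_N`, the surface measure of the unit sphere of `ℝ^N`. -/
def sphereArea (N : ℕ) : ℝ :=
  ((volume : Measure (EuclideanSpace ℝ (Fin N))).toSphere).real univ

/-- The fundamental solution `1 / ((N - 2) σ_N |z|^(N - 2))` of `-Δ` on `ℝ^N`, for `N ≥ 3`. -/
def fundSol {N : ℕ} (z : EuclideanSpace ℝ (Fin N)) : ℝ :=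
  1 / (((N : ℝ) - 2) * sphereArea N * ‖z‖ ^ (N - 2))

/-- `h` is the corrector of `Ω` with pole `x`: the classical solution of the Dirichlet problem
`Δ h = 0` in `Ω`, `h(y) = 1 / ((N - 2) σ_N |x - y|^(N - 2))` for `y` on the boundary. -/
structure IsCorrector {N : ℕ} (Ω : Set (EuclideanSpace ℝ (Fin N)))
    (x : EuclideanSpace ℝ (Fin N)) (h : EuclideanSpace ℝ (Fin N) → ℝ) : Prop where
  continuousOn : ContinuousOn h (closure Ω)
  harmonic : HarmonicOnNhd h Ω
  boundary : ∀ y ∈ frontier Ω, h y = fundSol (x - y)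

/-- `G` is the Green's function of `-Δ` on `Ω` under Dirichlet boundary conditions: for every
pole `x ∈ Ω`, the function `G(x, ·)` is the fundamental solution with pole `x` minus the corrector,
i.e. `-Δ_y G(x, y) = δ_x(y)` in `Ω` and `G(x, y) = 0` for `y` on the boundary.
The value `G(x, x)`, morally `+∞`, is left free. -/
def IsGreenFunction {N : ℕ} (Ω : Set (EuclideanSpace ℝ (Fin N)))
    (G : EuclideanSpace ℝ (Fin N) → EuclideanSpace ℝ (Fin N) → ℝ) : Prop :=
  ∀ x ∈ Ω, ∃ h : EuclideanSpace ℝ (Fin N) → ℝ, IsCorrector Ω x h ∧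
    ∀ y ∈ closure Ω, y ≠ x → G x y = fundSol (x - y) - h y

open Classical in
/-- The regular part `H(x, y) = 1 / ((N - 2) σ_N |x - y|^(N - 2)) - G(x, y)` of `G`, extended to
the diagonal by continuity in `y`. -/
def regularPart {N : ℕ} (G : EuclideanSpace ℝ (Fin N) → EuclideanSpace ℝ (Fin N) → ℝ)
    (x y : EuclideanSpace ℝ (Fin N)) : ℝ :=
  if y = x then limUnder (𝓝[≠] x) (fun z => fundSol (x - z) - G x z)
  else fundSol (x - y) - G x y

/-- `d(x)`, the distance of `x` to the boundary of `Ω`. -/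
def bdryDist {N : ℕ} (Ω : Set (EuclideanSpace ℝ (Fin N))) (x : EuclideanSpace ℝ (Fin N)) : ℝ :=
  Metric.infDist x (frontier Ω)

/-- `p` is a boundary point of `Ω` nearest to `x`. -/
def IsNearestBdryPt {N : ℕ} (Ω : Set (EuclideanSpace ℝ (Fin N)))
    (x p : EuclideanSpace ℝ (Fin N)) : Prop :=
  p ∈ frontier Ω ∧ dist x p = bdryDist Ω x

/-- The projection `p(x)` of `x` onto the boundary of `Ω`: the nearest boundary point, wherever
that point is unique. -/
def bdryProj {N : ℕ} (Ω : Set (EuclideanSpace ℝ (Fin N))) (x : EuclideanSpace ℝ (Fin N)) :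
    EuclideanSpace ℝ (Fin N) :=
  Classical.epsilon (IsNearestBdryPt Ω x)

/-- The reflection `2 p(x) - x` of `x` at the boundary of `Ω`. -/
def bdryReflection {N : ℕ} (Ω : Set (EuclideanSpace ℝ (Fin N))) (x : EuclideanSpace ℝ (Fin N)) :
    EuclideanSpace ℝ (Fin N) :=
  (2 : ℝ) • bdryProj Ω x - x

/-- The inward unit normal `ν_x = (x - p(x)) / |x - p(x)|` at `p(x)`. -/
def inwardNormal {N : ℕ} (Ω : Set (EuclideanSpace ℝ (Fin N))) (x : EuclideanSpace ℝ (Fin N)) :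
    EuclideanSpace ℝ (Fin N) :=
  ‖x - bdryProj Ω x‖⁻¹ • (x - bdryProj Ω x)

end

/-!
Everything is reduced to estimates on the boundary by the weak maximum principle for harmonic
functions on a bounded open set (`HarmonicContOnCl.nonpos_of_frontier`).

Geometry. A bounded set with `C²` boundary has, for one radius `r`, an interior and an exterior
tangent ball at every boundary point (`HasC2Boundary.exists_hasTangentBalls`): locally it is
`{F > 0}` for a `C²` function `F` with `|∇F| ≥ 1`, and Taylor's formula together with compactness
of the boundary gives `r`. If `p` is a boundary point with inward unit normal `n`, the two balls
show that `|⟨n, z - p⟩| ≤ |z - p|² / (2r)` for `z` on the boundary, that `p` is the only nearest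
boundary point of `p + τ n` for `0 < τ < r`, and that `p - τ n` lies outside the closure. Moreover
every point of the layer has this form. So moving `x = p + d n` along its normal
leaves `p` and `n` unchanged and moves the reflection `p - d n` in the opposite direction.

Estimates. Let `m = N - 2` and let `z` be a boundary point. The squared distances of `z` to
`p + τ n` and `p - τ n` differ by `4τ |⟨n, z - p⟩| ≤ 2τ |z - p|² / r`, so the potentials
`|p ± τ n - z|^(-m)` differ by `O(τ) |p - τ n - z|^(-m)` (`abs_one_div_pow_sub_le`), and the
derivative in `τ` of their difference is `O(1) |p - τ n - z|^(-m)` (`abs_normal_deriv_le`). The right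
sides are multiples of a function harmonic in `Ω`, because the reflected pole is outside. Hence the
maximum principle carries the first bound from the boundary to `y ∈ Ω`, which is the expansion of
`H`. For the normal derivative the same is done with increments in `τ`
(`HasTangentBalls.abs_increment_sub_reflected_le`), so that harmonicity of `∂H/∂ν` is not needed.
The derivative of `H` in the pole exists because its difference quotients are uniformly Cauchy on
the boundary, hence in `Ω` (`HasTangentBalls.differentiableAt_pole`); no symmetry of `H` is used.
-/

/-! ### The second derivative test and the weak maximum principle -/

section General
variable {E : Type*} [NormedAddCommGroup E] [InnerProductSpace ℝ E]

theorem hasDerivAt_comp_line {F : Type*} [NormedAddCommGroup F] [NormedSpace ℝ F] {f : E → F}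
    {y v : E} {t : ℝ} (hf : DifferentiableAt ℝ f (y + t • v)) :
    HasDerivAt (fun t : ℝ => f (y + t • v)) (fderiv ℝ f (y + t • v) v) t := by
  have h : HasDerivAt (fun t : ℝ => y + t • v) v t := by
    simpa using ((hasDerivAt_id t).smul_const v).const_add y
  exact hf.hasFDerivAt.comp_hasDerivAt t h

theorem iteratedFDeriv_two_diag_eq_deriv_deriv {f : E → ℝ} {y : E} (hf : ContDiffAt ℝ 2 f y)
    (v : E) :
    iteratedFDeriv ℝ 2 f y ![v, v] = deriv (deriv fun t : ℝ => f (y + t • v)) 0 := by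
  have hcont : Tendsto (fun t : ℝ => y + t • v) (𝓝 0) (𝓝 y) := by
    have : Continuous fun t : ℝ => y + t • v := by fun_prop
    simpa using this.tendsto 0
  have hev : ∀ᶠ z in 𝓝 y, DifferentiableAt ℝ f z :=
    (hf.eventually (by simp)).mono fun z hz => hz.differentiableAt (by simp)
  have h1 : deriv (fun t : ℝ => f (y + t • v)) =ᶠ[𝓝 0] fun t => fderiv ℝ f (y + t • v) v :=
    (hcont.eventually hev).mono fun t ht => (hasDerivAt_comp_line ht).deriv
  have h2 : DifferentiableAt ℝ (fderiv ℝ f) (y + (0 : ℝ) • v) := by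
    simpa using (hf.fderiv_right (m := 1) (by norm_num)).differentiableAt (by simp)
  rw [h1.deriv_eq, iteratedFDeriv_two_apply]
  have h3 := (hasDerivAt_comp_line h2).clm_apply (hasDerivAt_const (0 : ℝ) v)
  simpa using h3.deriv.symm

theorem IsLocalMax.deriv_deriv_nonpos {g : ℝ → ℝ} {a : ℝ} (h : IsLocalMax g a)
    (hc : ContinuousAt g a) : deriv (deriv g) a ≤ 0 := by
  by_contra! hpos
  have hmin := isLocalMin_of_deriv_deriv_pos hpos h.deriv_eq_zero hc
  have hconst : g =ᶠ[𝓝 a] fun _ => g a := by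
    filter_upwards [h, hmin] with x h1 h2 using le_antisymm h1 h2
  have : deriv (deriv g) a = 0 := by
    rw [hconst.deriv.deriv_eq]; simp
  exact hpos.ne' this

variable [FiniteDimensional ℝ E]

theorem IsLocalMax.laplacian_nonpos {f : E → ℝ} {y : E} (h : IsLocalMax f y)
    (hf : ContDiffAt ℝ 2 f y) : Laplacian.laplacian f y ≤ 0 := by
  rw [laplacian_eq_iteratedFDeriv_stdOrthonormalBasis]
  refine Finset.sum_nonpos fun i _ => ?_
  rw [iteratedFDeriv_two_diag_eq_deriv_deriv hf]
  have hc : Continuous fun t : ℝ => y + t • stdOrthonormalBasis ℝ E i := by fun_prop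
  have h0 : y + (0 : ℝ) • stdOrthonormalBasis ℝ E i = y := by simp
  refine IsLocalMax.deriv_deriv_nonpos ?_ ?_
  · have : Tendsto (fun t : ℝ => y + t • stdOrthonormalBasis ℝ E i) (𝓝 0) (𝓝 y) := by
      simpa using hc.tendsto 0
    simpa [IsLocalMax, IsMaxFilter] using this.eventually h
  · exact ContinuousAt.comp (f := fun t : ℝ => y + t • stdOrthonormalBasis ℝ E i) (g := f)
      (by rw [h0]; exact hf.continuousAt) hc.continuousAt

theorem laplacian_norm_sq (y : E) :
    Laplacian.laplacian (fun z : E => ‖z‖ ^ 2) y = 2 * Module.finrank ℝ E := by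
  rw [laplacian_eq_iteratedFDeriv_stdOrthonormalBasis]
  have h : ∀ i, iteratedFDeriv ℝ 2 (fun z : E => ‖z‖ ^ 2) y
      ![stdOrthonormalBasis ℝ E i, stdOrthonormalBasis ℝ E i] = 2 := by
    intro i
    rw [iteratedFDeriv_two_diag_eq_deriv_deriv (contDiff_norm_sq ℝ).contDiffAt]
    have e : (fun t : ℝ => ‖y + t • stdOrthonormalBasis ℝ E i‖ ^ 2) =
        fun t => ‖y‖ ^ 2 + 2 * (t * inner ℝ y (stdOrthonormalBasis ℝ E i)) + t ^ 2 := by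
      funext t
      rw [norm_add_sq_real, inner_smul_right, norm_smul]
      simp
    have e1 : deriv (fun t => ‖y‖ ^ 2 + 2 * (t * inner ℝ y (stdOrthonormalBasis ℝ E i)) + t ^ 2)
        = fun t : ℝ => 2 * inner ℝ y (stdOrthonormalBasis ℝ E i) + 2 * t := by
      funext t
      have := ((((hasDerivAt_id t).mul_const (inner ℝ y (stdOrthonormalBasis ℝ E i))).const_mul
        2).const_add (‖y‖ ^ 2)).fun_add (hasDerivAt_pow 2 t)
      simpa using this.deriv
    rw [e, e1]
    simp
  simp [h, mul_comm]

/-- Weak maximum principle: adding the strictly subharmonic `ε ‖z‖ ^ 2` rules out an interior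
maximum. -/
theorem InnerProductSpace.HarmonicContOnCl.nonpos_of_frontier [Nontrivial E] {u : E → ℝ} {s : Set E}
    (hu : HarmonicContOnCl u s) (hb : Bornology.IsBounded s)
    (hfr : ∀ z ∈ frontier s, u z ≤ 0) {y : E} (hy : y ∈ s) : u y ≤ 0 := by
  by_contra! hpos
  obtain ⟨R, hR, hsR⟩ := hb.closure.exists_pos_norm_le
  obtain ⟨ε, hε, hεy⟩ : ∃ ε > 0, ε * R ^ 2 < u y :=
    ⟨u y / (2 * R ^ 2), by positivity, by field_simp; linarith⟩
  have hcpt : IsCompact (closure s) := hb.isCompact_closure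
  obtain ⟨z, hz, hmax⟩ := hcpt.exists_isMaxOn ⟨y, subset_closure hy⟩
    (f := fun z => u z + ε * ‖z‖ ^ 2) (hu.2.add (by fun_prop))
  have hyz : u y + ε * ‖y‖ ^ 2 ≤ u z + ε * ‖z‖ ^ 2 := hmax (subset_closure hy)
  have hzi : z ∈ interior s := by
    by_contra hzi
    have h1 := hfr z ⟨hz, hzi⟩
    have h2 : ‖z‖ ^ 2 ≤ R ^ 2 := by gcongr; exact hsR z hz
    nlinarith [mul_le_mul_of_nonneg_left h2 hε.le, mul_nonneg hε.le (sq_nonneg ‖y‖)]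
  have hloc : IsLocalMax (fun z => u z + ε * ‖z‖ ^ 2) z :=
    hmax.isLocalMax (mem_of_superset (mem_interior_iff_mem_nhds.1 hzi) subset_closure)
  have huz := hu.1 z (interior_subset hzi)
  have hn : ContDiffAt ℝ 2 (fun z : E => ‖z‖ ^ 2) z := (contDiff_norm_sq ℝ).contDiffAt
  have hn' : ContDiffAt ℝ 2 (ε • fun z : E => ‖z‖ ^ 2) z := contDiffAt_const.smul hn
  have hle : Laplacian.laplacian (u + ε • fun z : E => ‖z‖ ^ 2) z ≤ 0 :=
    IsLocalMax.laplacian_nonpos hloc (huz.1.add hn')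
  rw [huz.1.laplacian_add hn', laplacian_smul _ hn, laplacian_norm_sq, huz.2.eq_of_nhds] at hle
  have : (0 : ℝ) < Module.finrank ℝ E := by exact_mod_cast Module.finrank_pos
  simp only [Pi.zero_apply, zero_add, smul_eq_mul] at hle
  nlinarith [mul_pos hε this]

end General

/-! ### Derivatives and harmonicity of negative powers of the norm -/

section General
variable {E : Type*} [NormedAddCommGroup E] [InnerProductSpace ℝ E]

theorem hasDerivAt_one_div_norm_pow (m : ℕ) {v n : E} {t : ℝ} (h : v + t • n ≠ 0) :
    HasDerivAt (fun t : ℝ => 1 / ‖v + t • n‖ ^ m)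
      (-(m * inner ℝ n (v + t • n)) / ‖v + t • n‖ ^ (m + 2)) t := by
  have hl : HasDerivAt (fun t : ℝ => v + t • n) n t := by
    simpa using ((hasDerivAt_id t).smul_const n).const_add v
  have hpos : 0 < ‖v + t • n‖ := norm_pos_iff.2 h
  have hn : HasDerivAt (fun t : ℝ => ‖v + t • n‖) (inner ℝ n (v + t • n) / ‖v + t • n‖) t := by
    have h1 := hl.norm_sq.sqrt (by positivity)
    simp only [Real.sqrt_sq (norm_nonneg _)] at h1
    refine h1.congr_deriv ?_
    rw [real_inner_comm]
    field_simp
  have h2 := (hn.fun_pow m).fun_inv (by positivity)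
  simp only [one_div]
  refine h2.congr_deriv ?_
  rcases m with _ | k
  · simp
  · simp only [Nat.add_sub_cancel]
    field_simp
    ring

theorem contDiffAt_one_div_norm_pow (m : ℕ) {a y : E} (h : y ≠ a) :
    ContDiffAt ℝ 2 (fun y : E => 1 / ‖a - y‖ ^ m) y := by
  have h0 : a - y ≠ 0 := sub_ne_zero.2 h.symm
  have h1 : ContDiffAt ℝ 2 (fun y : E => ‖a - y‖) y :=
    (contDiffAt_const.sub contDiffAt_id).norm ℝ h0
  exact contDiffAt_const.div (h1.pow m) (by have := norm_pos_iff.2 h0; positivity)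

theorem iteratedFDeriv_two_diag_one_div_norm_pow (m : ℕ) {a y : E} (h : y ≠ a) (e : E)
    (he : ‖e‖ = 1) :
    iteratedFDeriv ℝ 2 (fun y : E => 1 / ‖a - y‖ ^ m) y ![e, e] =
      m * ((m + 2) * inner ℝ e (a - y) ^ 2 / ‖a - y‖ ^ (m + 4) - 1 / ‖a - y‖ ^ (m + 2)) := by
  rw [iteratedFDeriv_two_diag_eq_deriv_deriv (contDiffAt_one_div_norm_pow m h)]
  have h0 : a - y + (0 : ℝ) • -e ≠ 0 := by simpa [sub_eq_zero] using h.symm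
  have hev : ∀ᶠ t : ℝ in 𝓝 0, a - y + t • -e ≠ 0 :=
    ContinuousAt.eventually_ne (by fun_prop) h0
  have e1 : (fun t : ℝ => 1 / ‖a - (y + t • e)‖ ^ m) = fun t : ℝ => 1 / ‖a - y + t • -e‖ ^ m := by
    funext t; congr 3; rw [smul_neg]; abel
  have e2 : deriv (fun t : ℝ => 1 / ‖a - y + t • -e‖ ^ m) =ᶠ[𝓝 0] fun t =>
      -(m * inner ℝ (-e) (a - y + t • -e)) * (1 / ‖a - y + t • -e‖ ^ (m + 2)) := by
    filter_upwards [hev] with t ht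
    rw [(hasDerivAt_one_div_norm_pow m ht).deriv]; ring
  rw [e1, e2.deriv_eq]
  have hl : HasDerivAt (fun t : ℝ => a - y + t • -e) (-e) 0 := by
    simpa using ((hasDerivAt_id (0 : ℝ)).smul_const (-e)).const_add (a - y)
  have h1 := (((hasDerivAt_const (0 : ℝ) (-e)).inner ℝ hl).const_mul (m : ℝ)).fun_neg.fun_mul
    (hasDerivAt_one_div_norm_pow (m + 2) h0)
  rw [h1.deriv]
  have hpos : 0 < ‖a - y‖ := norm_pos_iff.2 (sub_ne_zero.2 h.symm)
  simp only [zero_smul, add_zero, inner_neg_left, inner_neg_right, real_inner_self_eq_norm_sq, he,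
    inner_zero_left]
  push_cast
  field_simp
  ring

theorem harmonicAt_one_div_norm_pow [FiniteDimensional ℝ E] {m : ℕ}
    (hm : Module.finrank ℝ E = m + 2) {a y : E} (h : y ≠ a) :
    HarmonicAt (fun y : E => 1 / ‖a - y‖ ^ m) y := by
  refine ⟨contDiffAt_one_div_norm_pow m h, ?_⟩
  filter_upwards [isOpen_ne.mem_nhds h] with z hz
  rw [laplacian_eq_iteratedFDeriv_stdOrthonormalBasis]
  have hpos : 0 < ‖a - z‖ := norm_pos_iff.2 (sub_ne_zero.2 (Ne.symm hz))
  simp only [iteratedFDeriv_two_diag_one_div_norm_pow m hz _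
    ((stdOrthonormalBasis ℝ E).orthonormal.1 _), Pi.zero_apply]
  rw [← Finset.mul_sum, Finset.sum_sub_distrib, ← Finset.sum_div, ← Finset.mul_sum,
    OrthonormalBasis.sum_sq_inner_right]
  simp only [Finset.sum_const, Finset.card_univ, Fintype.card_fin, hm, nsmul_eq_mul]
  push_cast
  field_simp
  ring

end General

/-! ### Tangent balls of a `C²` boundary and the nearest point projection -/

section General
variable {E : Type*} [NormedAddCommGroup E] [InnerProductSpace ℝ E]

/-- `n` is a unit vector such that the balls of radius `r` tangent to the boundary of `s` at `p`,
with centres `p + r n` and `p - r n`, lie inside `s` and outside `s` respectively. -/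
structure HasTangentBalls (s : Set E) (p : E) (r : ℝ) (n : E) : Prop where
  norm_eq_one : ‖n‖ = 1
  ball_subset : Metric.ball (p + r • n) r ⊆ s
  ball_disjoint : Disjoint (Metric.ball (p - r • n) r) s

theorem HasTangentBalls.mono {s : Set E} {p n : E} {r r' : ℝ} (h : HasTangentBalls s p r n)
    (hr : r' ≤ r) : HasTangentBalls s p r' n := by
  have hd : ∀ σ : ℝ, |σ| = 1 → r' + dist (p + (σ * r') • n) (p + (σ * r) • n) ≤ r := by
    intro σ hσ
    rw [dist_add_left, dist_eq_norm, ← sub_smul, norm_smul, h.norm_eq_one, ← mul_sub,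
      Real.norm_eq_abs, abs_mul, hσ, abs_of_nonpos (by linarith)]
    linarith
  refine ⟨h.norm_eq_one, (Metric.ball_subset_ball' ?_).trans h.ball_subset,
    h.ball_disjoint.mono_left (Metric.ball_subset_ball' ?_)⟩
  · simpa using hd 1 (by simp)
  · simpa [sub_eq_add_neg] using hd (-1) (by simp)

theorem norm_sub_smul_sq {n : E} (hn : ‖n‖ = 1) (w : E) (t : ℝ) :
    ‖w - t • n‖ ^ 2 = ‖w‖ ^ 2 - 2 * t * inner ℝ n w + t ^ 2 := by
  rw [norm_sub_sq_real, inner_smul_right, norm_smul, hn, real_inner_comm, mul_one,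
    Real.norm_eq_abs, sq_abs]
  ring

theorem norm_add_smul_sq {n : E} (hn : ‖n‖ = 1) (w : E) (t : ℝ) :
    ‖w + t • n‖ ^ 2 = ‖w‖ ^ 2 + 2 * t * inner ℝ n w + t ^ 2 := by
  have := norm_sub_smul_sq hn w (-t)
  rw [neg_smul, sub_neg_eq_add] at this
  rw [this]; ring

/-- The boundary is tangent to second order to the hyperplane normal to `n`. -/
theorem HasTangentBalls.abs_inner_le {s : Set E} {p n z : E} {r : ℝ} (hs : IsOpen s)
    (h : HasTangentBalls s p r n) (hr : 0 < r) (hz : z ∈ frontier s) :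
    |inner ℝ n (z - p)| ≤ ‖z - p‖ ^ 2 / (2 * r) := by
  have h1 : z ∉ Metric.ball (p + r • n) r := fun hm =>
    (hs.frontier_eq ▸ hz).2 (h.ball_subset hm)
  have h2 : z ∉ Metric.ball (p - r • n) r := fun hm =>
    (h.ball_disjoint.closure_right Metric.isOpen_ball).le_bot ⟨hm, frontier_subset_closure hz⟩
  rw [Metric.mem_ball, not_lt, dist_eq_norm] at h1 h2
  have e1 := norm_sub_smul_sq h.norm_eq_one (z - p) r
  have e2 := norm_add_smul_sq h.norm_eq_one (z - p) r
  rw [show z - p - r • n = z - (p + r • n) by abel] at e1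
  rw [show z - p + r • n = z - (p - r • n) by abel] at e2
  have h3 : r ^ 2 ≤ ‖z - (p + r • n)‖ ^ 2 := by gcongr
  have h4 : r ^ 2 ≤ ‖z - (p - r • n)‖ ^ 2 := by gcongr
  rw [le_div_iff₀ (by positivity), ← abs_of_pos (show 0 < 2 * r by positivity), ← abs_mul, abs_le]
  constructor <;> nlinarith

theorem ball_infDist_frontier_subset {s : Set E} (hs : IsOpen s) {x : E} (hx : x ∈ s) :
    Metric.ball x (Metric.infDist x (frontier s)) ⊆ s := by
  rcases (Metric.infDist_nonneg (x := x) (s := frontier s)).eq_or_lt with h0 | h0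
  · simp [← h0]
  refine (convex_ball x _).isPreconnected.subset_left_of_subset_union hs
    (isClosed_closure (s := s)).isOpen_compl
    (disjoint_compl_right.mono_left subset_closure) ?_ ⟨x, Metric.mem_ball_self h0, hx⟩
  intro z hz
  by_contra hcon
  simp only [mem_union, mem_compl_iff, not_or, not_not] at hcon
  have hzf : z ∈ frontier s := by rw [hs.frontier_eq]; exact ⟨hcon.2, hcon.1⟩
  have := Metric.infDist_le_dist_of_mem (x := x) hzf
  rw [Metric.mem_ball, dist_comm] at hz
  exact absurd hz (not_lt.2 this)

/-- The segment to a nearest boundary point hits the boundary along the normal `n`: the ball about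
`x` and the exterior tangent ball are disjoint, so they touch at `p`. -/
theorem HasTangentBalls.sub_eq_smul {s : Set E} {x p n : E} {r : ℝ} (hs : IsOpen s)
    (h : HasTangentBalls s p r n) (hr : 0 < r) (hx : x ∈ s) (hp : p ∈ frontier s)
    (hxp : dist x p = Metric.infDist x (frontier s)) :
    x = p + Metric.infDist x (frontier s) • n := by
  set d := Metric.infDist x (frontier s) with hd
  have hpos : 0 < d := by
    rw [← hxp, dist_pos]
    rintro rfl
    exact (hs.frontier_eq ▸ hp).2 hx
  have hdisj : Disjoint (Metric.ball x d) (Metric.ball (p - r • n) r) :=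
    (h.ball_disjoint.mono_right (ball_infDist_frontier_subset hs hx)).symm
  rw [disjoint_ball_ball_iff hpos hr, dist_eq_norm, show x - (p - r • n) = (x - p) + r • n by abel]
    at hdisj
  have e1 := norm_add_smul_sq h.norm_eq_one (x - p) r
  have e2 := norm_sub_smul_sq h.norm_eq_one (x - p) d
  have e3 : (d + r) ^ 2 ≤ ‖x - p + r • n‖ ^ 2 := by gcongr
  rw [dist_eq_norm] at hxp
  rw [hxp] at e1 e2
  have e4 : d ≤ inner ℝ n (x - p) := by nlinarith
  have e5 : ‖x - p - d • n‖ ^ 2 ≤ 0 := by nlinarith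
  have e6 : x - p - d • n = 0 := by
    have := pow_eq_zero_iff (two_ne_zero) |>.1 (le_antisymm e5 (sq_nonneg _))
    simpa using this
  rw [sub_sub, sub_eq_zero] at e6
  exact e6

/-- Quantitative form of the fact that for `t < r` the point `p + t n` of the normal has `p` as its
only nearest boundary point. -/
theorem HasTangentBalls.le_dist_sq {s : Set E} {p n z : E} {r t : ℝ} (hs : IsOpen s)
    (h : HasTangentBalls s p r n) (hr : 0 < r) (ht : 0 < t) (hz : z ∈ frontier s) :
    t ^ 2 + (1 - t / r) * ‖z - p‖ ^ 2 ≤ dist (p + t • n) z ^ 2 := by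
  have h1 := (abs_le.1 (h.abs_inner_le hs hr hz)).2
  rw [dist_comm, dist_eq_norm, ← sub_sub, norm_sub_smul_sq h.norm_eq_one]
  have h2 : 2 * t * inner ℝ n (z - p) ≤ 2 * t * (‖z - p‖ ^ 2 / (2 * r)) := by gcongr
  have h3 : 2 * t * (‖z - p‖ ^ 2 / (2 * r)) = t / r * ‖z - p‖ ^ 2 := by field_simp
  linarith

theorem HasTangentBalls.infDist_frontier {s : Set E} {p n : E} {r t : ℝ} (hs : IsOpen s)
    (h : HasTangentBalls s p r n) (hp : p ∈ frontier s) (ht : 0 < t) (htr : t < r) :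
    Metric.infDist (p + t • n) (frontier s) = t := by
  apply le_antisymm
  · refine (Metric.infDist_le_dist_of_mem hp).trans_eq ?_
    simp [norm_smul, h.norm_eq_one, abs_of_pos ht]
  · refine (Metric.le_infDist ⟨p, hp⟩).2 fun z hz => ?_
    have h1 := h.le_dist_sq hs (ht.trans htr) ht hz
    have h2 : t / r < 1 := (div_lt_one (ht.trans htr)).2 htr
    have h3 : 0 ≤ (1 - t / r) * ‖z - p‖ ^ 2 := mul_nonneg (by linarith) (sq_nonneg _)
    exact le_of_sq_le_sq (by linarith) dist_nonneg

theorem HasTangentBalls.eq_of_dist_eq {s : Set E} {p n q : E} {r t : ℝ} (hs : IsOpen s)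
    (h : HasTangentBalls s p r n) (ht : 0 < t) (htr : t < r) (hq : q ∈ frontier s)
    (hd : dist (p + t • n) q = t) : q = p := by
  have h1 := h.le_dist_sq hs (ht.trans htr) ht hq
  have h2 : t / r < 1 := (div_lt_one (ht.trans htr)).2 htr
  rw [hd] at h1
  have h3 : ‖q - p‖ ^ 2 ≤ 0 := by
    by_contra! hcon
    nlinarith [mul_pos (sub_pos.2 h2) hcon]
  have := pow_eq_zero_iff (two_ne_zero) |>.1 (le_antisymm h3 (sq_nonneg _))
  simpa [sub_eq_zero] using this

theorem HasTangentBalls.add_smul_mem {s : Set E} {p n : E} {r t : ℝ}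
    (h : HasTangentBalls s p r n) (ht : 0 < t) (htr : t < r) : p + t • n ∈ s := by
  refine h.ball_subset ?_
  rw [Metric.mem_ball, dist_add_left, dist_eq_norm, ← sub_smul, norm_smul, h.norm_eq_one,
    Real.norm_eq_abs, abs_of_nonpos (by linarith)]
  linarith

theorem HasTangentBalls.sub_smul_notMem_closure {s : Set E} {p n : E} {r t : ℝ}
    (h : HasTangentBalls s p r n) (ht : 0 < t) (htr : t < r) : p - t • n ∉ closure s := by
  intro hm
  refine (h.ball_disjoint.closure_right Metric.isOpen_ball).le_bot ⟨?_, hm⟩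
  rw [Metric.mem_ball, dist_sub_left, dist_eq_norm, ← sub_smul, norm_smul, h.norm_eq_one,
    Real.norm_eq_abs, abs_of_nonpos (by linarith)]
  linarith

/-- A set that is locally the superlevel set `{F > 0}` of a `C²` function without critical points
has locally uniform tangent balls, by the second order Taylor estimate for `F`. -/
theorem exists_hasTangentBalls_nhds [CompleteSpace E] {s : Set E} (hs : IsOpen s) {F : E → ℝ}
    (hF : ContDiff ℝ 2 F) {e : E} (he : ‖e‖ = 1) (hFe : ∀ z, fderiv ℝ F z e = 1) {p₀ : E}
    (hloc : ∀ᶠ z in 𝓝 p₀, (z ∈ s ↔ 0 < F z)) :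
    ∃ r > 0, ∀ᶠ p in 𝓝 p₀, p ∈ frontier s → ∃ n, HasTangentBalls s p r n := by
  have hF1 : ContDiffAt ℝ 1 (fderiv ℝ F) p₀ :=
    (hF.fderiv_right (m := 1) (by norm_num)).contDiffAt
  obtain ⟨K, u, hu, hK⟩ := hF1.exists_lipschitzOnWith
  obtain ⟨R, hR, hRs⟩ := Metric.mem_nhds_iff.1 (inter_mem hu hloc)
  refine ⟨min (R / 4) (1 / (2 * (K + 1))), by positivity, ?_⟩
  set r := min (R / 4) (1 / (2 * ((K : ℝ) + 1)))
  have hr : 0 < r := by positivity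
  have hrR : r ≤ R / 4 := min_le_left _ _
  have hrK : 2 * r * (K + 1) ≤ 1 := by
    have : r ≤ 1 / (2 * ((K : ℝ) + 1)) := min_le_right _ _
    rw [le_div_iff₀ (by positivity)] at this
    linarith
  filter_upwards [Metric.ball_mem_nhds p₀ (half_pos hR)] with p hpR hp
  rw [Metric.mem_ball] at hpR
  have hmem : ∀ z, ‖z - p‖ < R / 2 → z ∈ Metric.ball p₀ R := fun z hz => by
    rw [← dist_eq_norm] at hz
    exact (dist_triangle z p p₀).trans_lt (by linarith)
  have hp0 : F p = 0 := by
    apply le_antisymm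
    · by_contra! hpos
      exact (hs.frontier_eq ▸ hp).2 ((hRs (hmem p (by simpa using half_pos hR))).2.2 hpos)
    · by_contra! hneg
      have h1 : ∀ᶠ z in 𝓝 p, F z < 0 := hF.continuous.continuousAt.eventually_lt_const hneg
      have h2 : ∀ᶠ z in 𝓝 p, z ∈ Metric.ball p₀ R :=
        Metric.isOpen_ball.mem_nhds (hmem p (by simpa using half_pos hR))
      obtain ⟨z, hz, hz1, hz2⟩ :=
        ((mem_closure_iff_frequently.1 (frontier_subset_closure hp)).and_eventually
          (h1.and h2)).exists
      exact absurd ((hRs hz2).2.1 hz) (not_lt.2 hz1.le)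
  have htaylor : ∀ z, ‖z - p‖ < R / 2 → |F z - fderiv ℝ F p (z - p)| ≤ K * ‖z - p‖ ^ 2 := by
    intro z hz
    have := (convex_closedBall p ‖z - p‖).norm_image_sub_le_of_norm_fderiv_le' (f := F)
      (φ := fderiv ℝ F p) (C := K * ‖z - p‖) (x := p) (y := z)
      (fun w _ => (hF.differentiable (by simp)).differentiableAt) (fun w hw => ?_)
      (Metric.mem_closedBall_self (norm_nonneg _)) (by simp [dist_eq_norm])
    · rw [hp0, sub_zero, Real.norm_eq_abs] at this
      linarith
    · rw [Metric.mem_closedBall, dist_eq_norm] at hw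
      have := hK.dist_le_mul w (hRs (hmem w (hw.trans_lt hz))).1 p
        (hRs (hmem p (by simpa using half_pos hR))).1
      rw [dist_eq_norm, dist_eq_norm] at this
      exact this.trans (by gcongr)
  set g := (InnerProductSpace.toDual ℝ E).symm (fderiv ℝ F p) with hg
  have hgi : ∀ w, fderiv ℝ F p w = inner ℝ g w := fun w => by
    rw [hg, InnerProductSpace.toDual_symm_apply]
  have hg1 : 1 ≤ ‖g‖ := by
    have := real_inner_le_norm g e
    rwa [← hgi, hFe, he, mul_one] at this
  have hgn : ∀ w, fderiv ℝ F p w = ‖g‖ * inner ℝ (‖g‖⁻¹ • g) w := fun w => by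
    rw [hgi, real_inner_smul_left, ← mul_assoc, mul_inv_cancel₀ (by linarith), one_mul]
  have hn : ‖‖g‖⁻¹ • g‖ = 1 := by
    rw [norm_smul, norm_inv, norm_norm, inv_mul_cancel₀ (by linarith)]
  set n := ‖g‖⁻¹ • g
  have hsmall : ∀ z : E, ∀ σ : ℝ, |σ| = 1 → dist z (p + (σ * r) • n) < r → ‖z - p‖ < R / 2 := by
    intro z σ hσ hz
    have : dist (p + (σ * r) • n) p = r := by
      simp [norm_smul, hn, hσ, abs_of_pos hr]
    rw [← dist_eq_norm]
    linarith [dist_triangle z (p + (σ * r) • n) p]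
  -- In the ball on the side `σ = ±1` the linear part of `F` outweighs the quadratic Taylor error, so
  -- `F` has the sign of `σ` there.
  have hsign : ∀ z : E, ∀ σ : ℝ, |σ| = 1 → dist z (p + (σ * r) • n) < r → 0 < σ * F z := by
    intro z σ hσ hz
    have h1 := htaylor z (hsmall z σ hσ hz)
    have hσ2 : σ ^ 2 = 1 := by rw [← sq_abs, hσ, one_pow]
    have h2 := norm_sub_smul_sq hn (z - p) (σ * r)
    rw [sub_sub, ← dist_eq_norm] at h2
    have h3 : dist z (p + (σ * r) • n) ^ 2 < r ^ 2 := by gcongr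
    have h4 : ‖z - p‖ ^ 2 < 2 * r * (σ * inner ℝ n (z - p)) := by nlinarith
    have h5 : 0 < σ * inner ℝ n (z - p) := by
      by_contra! hcon
      nlinarith [sq_nonneg ‖z - p‖, mul_nonneg hr.le (neg_nonneg.2 hcon)]
    have h6 : σ * inner ℝ n (z - p) ≤ σ * fderiv ℝ F p (z - p) := by
      rw [hgn]; nlinarith
    have h7 : |σ * F z - σ * fderiv ℝ F p (z - p)| ≤ K * ‖z - p‖ ^ 2 := by
      rw [← mul_sub, abs_mul, hσ, one_mul]; exact h1
    have h8 := (abs_le.1 h7).1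
    have h9 : (K + 1) * ‖z - p‖ ^ 2 ≤ (K + 1) * (2 * r * (σ * inner ℝ n (z - p))) := by gcongr
    have h10 := mul_le_mul_of_nonneg_right hrK h5.le
    have h11 : 0 < ‖z - p‖ ^ 2 := by
      rcases (sq_nonneg ‖z - p‖).eq_or_lt with h | h
      · have : z - p = 0 := by simpa using h.symm
        rw [this] at h5; simp at h5
      · exact h
    nlinarith
  refine ⟨n, hn, fun z hz => ?_, Set.disjoint_left.2 fun z hz hzs => ?_⟩
  · have hz' : dist z (p + ((1 : ℝ) * r) • n) < r := by simpa using hz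
    have := hsign z 1 (by simp) hz'
    exact (hRs (hmem z (hsmall z 1 (by simp) hz'))).2.2 (by linarith)
  · have hz' : dist z (p + ((-1 : ℝ) * r) • n) < r := by simpa [sub_eq_add_neg] using hz
    have := hsign z (-1) (by simp) hz'
    linarith [(hRs (hmem z (hsmall z (-1) (by simp) hz'))).2.1 hzs]

end General

/-- The two-sided ball condition with a radius that does not depend on the boundary point. -/
theorem HasC2Boundary.exists_hasTangentBalls {N : ℕ} {Ω : Set (EuclideanSpace ℝ (Fin N))}
    (hopen : IsOpen Ω) (hbdd : Bornology.IsBounded Ω) (hC2 : HasC2Boundary Ω) :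
    ∃ r > 0, ∀ p ∈ frontier Ω, ∃ n, HasTangentBalls Ω p r n := by
  have hcpt : IsCompact (frontier Ω) :=
    hbdd.isCompact_closure.of_isClosed_subset isClosed_frontier frontier_subset_closure
  have hkey : ∃ r > 0, ∀ p ∈ frontier Ω, p ∈ frontier Ω → ∃ n, HasTangentBalls Ω p r n := by
    refine hcpt.induction_on
      (p := fun S => ∃ r > 0, ∀ p ∈ S, p ∈ frontier Ω → ∃ n, HasTangentBalls Ω p r n)
      ⟨1, one_pos, by simp⟩ ?_ ?_ ?_
    · rintro S T hST ⟨r, hr, h⟩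
      exact ⟨r, hr, fun p hp => h p (hST hp)⟩
    · rintro S T ⟨r, hr, h⟩ ⟨r', hr', h'⟩
      refine ⟨min r r', lt_min hr hr', ?_⟩
      rintro p (hp | hp) hpf
      · obtain ⟨n, hn⟩ := h p hp hpf
        exact ⟨n, hn.mono (min_le_left _ _)⟩
      · obtain ⟨n, hn⟩ := h' p hp hpf
        exact ⟨n, hn.mono (min_le_right _ _)⟩
    · intro p₀ hp₀
      obtain ⟨e, he, ρ, hρ, hloc⟩ := hC2 p₀ hp₀
      have hF : ContDiff ℝ 2 fun z : EuclideanSpace ℝ (Fin N) =>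
          (inner ℝ e z : ℝ) - ρ (z - (inner ℝ e z : ℝ) • e) := by
        have hi : ContDiff ℝ 2 fun z : EuclideanSpace ℝ (Fin N) => (inner ℝ e z : ℝ) :=
          contDiff_const.inner ℝ contDiff_id
        exact hi.sub (hρ.comp (contDiff_id.sub (hi.smul contDiff_const)))
      have hFe : ∀ z, fderiv ℝ (fun z : EuclideanSpace ℝ (Fin N) =>
          (inner ℝ e z : ℝ) - ρ (z - (inner ℝ e z : ℝ) • e)) z e = 1 := by
        intro z
        have h1 := hasDerivAt_comp_line (v := e) (t := 0)
          ((hF.differentiable (by simp)).differentiableAt (x := z + (0 : ℝ) • e))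
        -- Moving along `e` changes the height at unit speed and leaves the projection unchanged.
        have h2 : ∀ t : ℝ, (inner ℝ e (z + t • e) : ℝ)
            - ρ (z + t • e - (inner ℝ e (z + t • e) : ℝ) • e) =
            (inner ℝ e z : ℝ) - ρ (z - (inner ℝ e z : ℝ) • e) + t := by
          intro t
          have h3 : (inner ℝ e (z + t • e) : ℝ) = inner ℝ e z + t := by
            rw [inner_add_right, inner_smul_right, real_inner_self_eq_norm_sq, he]; ring
          rw [h3, add_smul]
          rw [add_sub_add_right_eq_sub]
          ring
        simp only [h2] at h1
        have h4 := h1.unique ((hasDerivAt_id (0 : ℝ)).const_add _)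
        simpa using h4
      obtain ⟨r, hr, h⟩ := exists_hasTangentBalls_nhds hopen hF he hFe
        (hloc.mono fun z hz => hz.trans sub_pos.symm)
      exact ⟨_, mem_nhdsWithin_of_mem_nhds h, r, hr, fun p hp => hp⟩
  obtain ⟨r, hr, h⟩ := hkey
  exact ⟨r, hr, fun p hp => h p hp hp⟩

section Reflection
variable {N : ℕ} {Ω : Set (EuclideanSpace ℝ (Fin N))} {p n : EuclideanSpace ℝ (Fin N)} {r t : ℝ}

theorem HasTangentBalls.isNearestBdryPt_iff (hopen : IsOpen Ω) (h : HasTangentBalls Ω p r n)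
    (hp : p ∈ frontier Ω) (ht : 0 < t) (htr : t < r) (q : EuclideanSpace ℝ (Fin N)) :
    IsNearestBdryPt Ω (p + t • n) q ↔ q = p := by
  have hd : bdryDist Ω (p + t • n) = t := h.infDist_frontier hopen hp ht htr
  constructor
  · rintro ⟨h1, h2⟩
    exact h.eq_of_dist_eq hopen ht htr h1 (h2.trans hd)
  · rintro rfl
    refine ⟨hp, ?_⟩
    rw [hd]
    simp [norm_smul, h.norm_eq_one, abs_of_pos ht]

theorem HasTangentBalls.bdryProj_eq (hopen : IsOpen Ω) (h : HasTangentBalls Ω p r n)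
    (hp : p ∈ frontier Ω) (ht : 0 < t) (htr : t < r) : bdryProj Ω (p + t • n) = p :=
  (h.isNearestBdryPt_iff hopen hp ht htr _).1 (Classical.epsilon_spec
    ⟨p, (h.isNearestBdryPt_iff hopen hp ht htr p).2 rfl⟩)

theorem HasTangentBalls.bdryReflection_eq (hopen : IsOpen Ω) (h : HasTangentBalls Ω p r n)
    (hp : p ∈ frontier Ω) (ht : 0 < t) (htr : t < r) :
    bdryReflection Ω (p + t • n) = p - t • n := by
  rw [bdryReflection, h.bdryProj_eq hopen hp ht htr, two_smul]
  abel

theorem HasTangentBalls.inwardNormal_eq (hopen : IsOpen Ω) (h : HasTangentBalls Ω p r n)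
    (hp : p ∈ frontier Ω) (ht : 0 < t) (htr : t < r) : inwardNormal Ω (p + t • n) = n := by
  rw [inwardNormal, h.bdryProj_eq hopen hp ht htr, add_sub_cancel_left, norm_smul, h.norm_eq_one,
    Real.norm_eq_abs, abs_of_pos ht, mul_one, smul_smul, inv_mul_cancel₀ ht.ne', one_smul]

end Reflection

/-! ### Comparison of the distances to a pole and to its reflection -/

section Estimates

/-- The squared distances `a ^ 2`, `b ^ 2` of a boundary point to `p + d n` and `p - d n` are
comparable. -/
theorem sq_le_of_reflected {a b W s d r : ℝ} (hd : 0 < d) (hdr : 2 * d ≤ r)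
    (hs : |s| ≤ W / (2 * r)) (ha2 : a ^ 2 = W - 2 * d * s + d ^ 2)
    (hb2 : b ^ 2 = W + 2 * d * s + d ^ 2) :
    W + d ^ 2 ≤ 2 * a ^ 2 ∧ W + d ^ 2 ≤ 2 * b ^ 2 ∧ 2 * a ^ 2 ≤ 3 * (W + d ^ 2) ∧
      2 * b ^ 2 ≤ 3 * (W + d ^ 2) := by
  have hr : 0 < r := by linarith
  have h1 : |2 * d * s| ≤ W / 2 := by
    rw [abs_mul, abs_of_pos (by positivity)]
    calc 2 * d * |s| ≤ r * (W / (2 * r)) := by gcongr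
      _ = W / 2 := by field_simp
  have := abs_le.1 h1
  refine ⟨?_, ?_, ?_, ?_⟩ <;> nlinarith

/-- Here `a`, `b` are the distances of a boundary point `z` to `p + d n` and `p - d n`, while
`W = ‖z - p‖ ^ 2` and `s = ⟪n, z - p⟫`. The bound on `s` makes `|a ^ 2 - b ^ 2|` as small as
`2 d W / r`. -/
theorem abs_one_div_pow_sub_le (k : ℕ) {a b W s d r : ℝ} (ha : 0 ≤ a) (hb : 0 ≤ b) (hd : 0 < d)
    (hdr : 2 * d ≤ r) (hW : 0 ≤ W) (hs : |s| ≤ W / (2 * r)) (ha2 : a ^ 2 = W - 2 * d * s + d ^ 2)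
    (hb2 : b ^ 2 = W + 2 * d * s + d ^ 2) :
    |1 / a ^ k - 1 / b ^ k| ≤ k * 2 ^ (k + 1) / r * (d / b ^ k) := by
  obtain ⟨h1, h2, h3, h4⟩ := sq_le_of_reflected hd hdr hs ha2 hb2
  have hr : 0 < r := by linarith
  have hd2 : 0 < d ^ 2 := by positivity
  have ha0 : 0 < a := ha.lt_of_ne' (by rintro rfl; nlinarith)
  have hb0 : 0 < b := hb.lt_of_ne' (by rintro rfl; nlinarith)
  have hba : b ≤ 2 * a := by
    apply le_of_sq_le_sq _ (by positivity); nlinarith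
  have h5 : |b - a| ≤ 4 * d * a / r := by
    have e1 : |b - a| * (b + a) = 4 * d * |s| := by
      rw [← abs_of_pos (show 0 < b + a by positivity), ← abs_mul,
        ← abs_of_pos (show 0 < 4 * d by positivity), ← abs_mul]
      congr 1; nlinarith
    have e2 : 4 * d * |s| ≤ 4 * d * (2 * a ^ 2 / (2 * r)) := by
      gcongr; refine hs.trans ?_; gcongr; linarith
    rw [le_div_iff₀ hr]
    have e3 : 4 * d * (2 * a ^ 2 / (2 * r)) * r = 4 * d * a * a := by field_simp
    have e4 : |b - a| * r * a ≤ 4 * d * a * a := by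
      rw [← e3]
      calc |b - a| * r * a = |b - a| * a * r := by ring
        _ ≤ |b - a| * (b + a) * r := by gcongr; linarith
        _ ≤ _ := by rw [e1]; gcongr
    exact le_of_mul_le_mul_right e4 ha0
  have h6 : |b ^ k - a ^ k| ≤ k * 2 ^ (k + 1) / r * d * a ^ k := by
    rcases k with _ | j
    · simp
    calc |b ^ (j + 1) - a ^ (j + 1)|
        ≤ |b - a| * ((j + 1 : ℕ) : ℝ) * max |b| |a| ^ (j + 1 - 1) := abs_pow_sub_pow_le ..
      _ ≤ (4 * d * a / r) * ((j + 1 : ℕ) : ℝ) * (2 * a) ^ (j + 1 - 1) := by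
          gcongr
          rw [abs_of_pos ha0, abs_of_pos hb0]
          exact max_le hba (by linarith)
      _ = _ := by
          rw [Nat.add_sub_cancel, mul_pow]; ring
  have h7 : 1 / a ^ k - 1 / b ^ k = (b ^ k - a ^ k) / (a ^ k * b ^ k) := by field_simp
  rw [h7, abs_div, abs_of_pos (show 0 < a ^ k * b ^ k by positivity), div_le_iff₀ (by positivity)]
  refine h6.trans_eq ?_
  field_simp

/-- In the notation of `abs_one_div_pow_sub_le`, the expression on the left is, up to the factor `m`,
the derivative in `d` of `1 / a ^ m - 1 / b ^ m`. The two terms with `d` are of order `1 / b ^ (m + 1)`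
each, and only their cancellation gives the bound. -/
theorem abs_normal_deriv_le (m : ℕ) {a b W s d r : ℝ} (ha : 0 ≤ a) (hb : 0 ≤ b) (hd : 0 < d)
    (hdr : 2 * d ≤ r) (hW : 0 ≤ W) (hs : |s| ≤ W / (2 * r)) (ha2 : a ^ 2 = W - 2 * d * s + d ^ 2)
    (hb2 : b ^ 2 = W + 2 * d * s + d ^ 2) :
    |(s - d) / a ^ (m + 2) + (s + d) / b ^ (m + 2)| ≤
      (2 ^ m + 1 + (m + 2) * 2 ^ (m + 4)) / r * (1 / b ^ m) := by
  obtain ⟨h1, h2, h3, h4⟩ := sq_le_of_reflected hd hdr hs ha2 hb2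
  have h0 := abs_one_div_pow_sub_le (m + 2) ha hb hd hdr hW hs ha2 hb2
  have hr : 0 < r := by linarith
  have hd2 : 0 < d ^ 2 := by positivity
  have ha0 : 0 < a := ha.lt_of_ne' (by rintro rfl; nlinarith)
  have hb0 : 0 < b := hb.lt_of_ne' (by rintro rfl; nlinarith)
  have hba : b ≤ 2 * a := by
    apply le_of_sq_le_sq _ (by positivity); nlinarith
  have key : ∀ c : ℝ, 0 < c → W + d ^ 2 ≤ 2 * c ^ 2 → |s / c ^ (m + 2)| ≤ 1 / r * (1 / c ^ m) := by
    intro c hc hWc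
    rw [abs_div, abs_of_pos (show 0 < c ^ (m + 2) by positivity), div_le_iff₀ (by positivity)]
    calc |s| ≤ W / (2 * r) := hs
      _ ≤ (2 * c ^ 2) / (2 * r) := by gcongr; linarith
      _ = _ := by field_simp; ring
  have e1 : |s / a ^ (m + 2)| ≤ 2 ^ m / r * (1 / b ^ m) := by
    refine (key a ha0 h1).trans ?_
    have : b ^ m ≤ 2 ^ m * a ^ m := by rw [← mul_pow]; gcongr
    have : 1 / a ^ m ≤ 2 ^ m * (1 / b ^ m) := by
      rw [mul_one_div, div_le_div_iff₀ (by positivity) (by positivity)]; linarith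
    calc 1 / r * (1 / a ^ m) ≤ 1 / r * (2 ^ m * (1 / b ^ m)) := by gcongr
      _ = _ := by ring
  have e2 := key b hb0 h2
  have e3 : |d * (1 / a ^ (m + 2) - 1 / b ^ (m + 2))| ≤
      (m + 2) * 2 ^ (m + 4) / r * (1 / b ^ m) := by
    rw [abs_mul, abs_of_pos hd]
    calc _ ≤ d * (((m + 2 : ℕ) : ℝ) * 2 ^ (m + 2 + 1) / r * (d / b ^ (m + 2))) := by gcongr
      _ = ((m + 2 : ℕ) : ℝ) * 2 ^ (m + 2 + 1) / r * (d ^ 2 / b ^ (m + 2)) := by ring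
      _ ≤ ((m + 2 : ℕ) : ℝ) * 2 ^ (m + 2 + 1) / r * ((2 * b ^ 2) / b ^ (m + 2)) := by
          gcongr; linarith
      _ = _ := by push_cast; field_simp; ring
  have e4 : (s - d) / a ^ (m + 2) + (s + d) / b ^ (m + 2) =
      s / a ^ (m + 2) + s / b ^ (m + 2) - d * (1 / a ^ (m + 2) - 1 / b ^ (m + 2)) := by ring
  rw [e4]
  refine (abs_sub _ _).trans ((add_le_add (abs_add_le _ _) le_rfl).trans ?_)
  calc _ ≤ 2 ^ m / r * (1 / b ^ m) + 1 / r * (1 / b ^ m) +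
        (m + 2) * 2 ^ (m + 4) / r * (1 / b ^ m) := by gcongr
    _ = _ := by ring

end Estimates

/-! ### Slopes depending on a parameter -/

section Slopes

theorem differentiableAt_of_slope_cauchy {f : ℝ → ℝ} {a : ℝ}
    (h : ∀ ε > 0, ∃ S ∈ 𝓝[≠] a, ∀ s ∈ S, ∀ t ∈ S,
      |slope f a s - slope f a t| ≤ ε) : DifferentiableAt ℝ f a := by
  have hc : Cauchy (map (slope f a) (𝓝[≠] a)) := by
    refine Metric.cauchy_iff.2 ⟨inferInstance, fun ε hε => ?_⟩
    obtain ⟨S, hS, hS'⟩ := h (ε / 2) (half_pos hε)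
    refine ⟨slope f a '' S, image_mem_map hS, ?_⟩
    rintro _ ⟨s, hs, rfl⟩ _ ⟨t, ht, rfl⟩
    rw [Real.dist_eq]
    exact (hS' s hs t ht).trans_lt (half_lt_self hε)
  obtain ⟨l, hl⟩ := cauchy_map_iff_exists_tendsto.1 hc
  exact (hasDerivAt_iff_tendsto_slope.2 hl).differentiableAt

/-- A family of functions whose derivatives depend continuously on a compact parameter is
differentiable uniformly in the parameter. -/
theorem eventually_abs_sub_sub_mul_le {α : Type*} [PseudoMetricSpace α] {K : Set α}
    (hK : IsCompact K) {f ψ : ℝ → α → ℝ} {a b d : ℝ} (had : a < d) (hdb : d < b)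
    (hψ : ContinuousOn (fun q : ℝ × α => ψ q.1 q.2) (Icc a b ×ˢ K))
    (hf : ∀ τ ∈ Icc a b, ∀ z ∈ K, HasDerivAt (fun t => f t z) (ψ τ z) τ) {ε : ℝ} (hε : 0 < ε) :
    ∀ᶠ τ in 𝓝 d, ∀ z ∈ K, |f τ z - f d z - (τ - d) * ψ d z| ≤ ε * |τ - d| := by
  obtain ⟨η, hη, hu⟩ := Metric.uniformContinuousOn_iff_le.1
    ((isCompact_Icc.prod hK).uniformContinuousOn_of_continuous hψ) ε hε
  filter_upwards [Metric.ball_mem_nhds d hη, Icc_mem_nhds had hdb] with τ hτ hτI z hz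
  have hsub : uIcc d τ ⊆ Icc a b := ordConnected_Icc.uIcc_subset ⟨had.le, hdb.le⟩ hτI
  have hder : ∀ t ∈ uIcc d τ, HasDerivWithinAt (fun t => f t z - (t - d) * ψ d z)
      (ψ t z - ψ d z) (uIcc d τ) t := fun t ht => by
    have := (hf t (hsub ht) z hz).fun_sub (((hasDerivAt_id t).sub_const d).mul_const (ψ d z))
    simpa using this.hasDerivWithinAt
  have := (convex_uIcc d τ).norm_image_sub_le_of_norm_hasDerivWithin_le hder (C := ε) (fun t ht => ?_)
    left_mem_uIcc right_mem_uIcc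
  · simpa [sub_right_comm] using this
  · rw [Real.norm_eq_abs, ← Real.dist_eq]
    refine hu (t, z) ⟨hsub ht, hz⟩ (d, z) ⟨⟨had.le, hdb.le⟩, hz⟩ ?_
    rw [Prod.dist_eq, dist_self, max_eq_left dist_nonneg]
    refine (abs_sub_left_of_mem_uIcc ht).trans ?_
    rw [← Real.dist_eq]; exact (Metric.mem_ball.1 hτ).le

end Slopes

/-! ### Potentials of reflected poles on the boundary -/

section Comparison
variable {E : Type*} [NormedAddCommGroup E] [InnerProductSpace ℝ E] {s : Set E} {p n z : E}
  {r τ : ℝ}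

theorem norm_add_smul_sub_sq (hn : ‖n‖ = 1) (p z : E) (τ : ℝ) :
    ‖p + τ • n - z‖ ^ 2 = ‖z - p‖ ^ 2 - 2 * τ * inner ℝ n (z - p) + τ ^ 2 := by
  rw [norm_sub_rev, ← sub_sub, norm_sub_smul_sq hn]

theorem norm_sub_smul_sub_sq (hn : ‖n‖ = 1) (p z : E) (τ : ℝ) :
    ‖p - τ • n - z‖ ^ 2 = ‖z - p‖ ^ 2 + 2 * τ * inner ℝ n (z - p) + τ ^ 2 := by
  rw [norm_sub_rev, ← sub_add, norm_add_smul_sq hn]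

theorem hasDerivAt_one_div_norm_add_smul_sub_pow (m : ℕ) (h : p + τ • n - z ≠ 0) :
    HasDerivAt (fun t : ℝ => 1 / ‖p + t • n - z‖ ^ m)
      (-(m * inner ℝ n (p + τ • n - z)) / ‖p + τ • n - z‖ ^ (m + 2)) τ := by
  simp only [add_sub_right_comm] at h ⊢
  exact hasDerivAt_one_div_norm_pow m h

theorem hasDerivAt_one_div_norm_sub_smul_sub_pow (m : ℕ) (h : p - τ • n - z ≠ 0) :
    HasDerivAt (fun t : ℝ => 1 / ‖p - t • n - z‖ ^ m)
      (m * inner ℝ n (p - τ • n - z) / ‖p - τ • n - z‖ ^ (m + 2)) τ := by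
  have e : ∀ t : ℝ, p - t • n = p + t • -n := fun t => by rw [smul_neg, sub_eq_add_neg]
  simp only [e] at h ⊢
  refine (hasDerivAt_one_div_norm_add_smul_sub_pow m h).congr_deriv ?_
  rw [inner_neg_left]; ring

/-- Moving both poles along the normal changes the difference of their potentials on the boundary
at a bounded rate relative to the potential of the reflected pole. -/
theorem HasTangentBalls.abs_deriv_potential_sub_le (hs : IsOpen s) (h : HasTangentBalls s p r n)
    (m : ℕ) (hτ : 0 < τ) (hτr : 2 * τ ≤ r) (hz : z ∈ frontier s) :
    ∃ D : ℝ, HasDerivAt (fun t : ℝ => 1 / ‖p + t • n - z‖ ^ m - 1 / ‖p - t • n - z‖ ^ m) D τ ∧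
      |D| ≤ m * ((2 ^ m + 1 + (m + 2) * 2 ^ (m + 4)) / r) * (1 / ‖p - τ • n - z‖ ^ m) := by
  have hr : 0 < r := by linarith
  have h1 : p + τ • n - z ≠ 0 := sub_ne_zero.2 fun h0 =>
    (hs.frontier_eq ▸ hz).2 (h0 ▸ h.add_smul_mem hτ (by linarith))
  have h2 : p - τ • n - z ≠ 0 := sub_ne_zero.2 fun h0 =>
    h.sub_smul_notMem_closure hτ (by linarith) (h0 ▸ frontier_subset_closure hz)
  refine ⟨_, (hasDerivAt_one_div_norm_add_smul_sub_pow m h1).fun_sub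
    (hasDerivAt_one_div_norm_sub_smul_sub_pow m h2), ?_⟩
  have h3 := abs_normal_deriv_le m (norm_nonneg (p + τ • n - z)) (norm_nonneg (p - τ • n - z))
    hτ hτr (sq_nonneg _) (h.abs_inner_le hs hr hz) (norm_add_smul_sub_sq h.norm_eq_one p z τ)
    (norm_sub_smul_sub_sq h.norm_eq_one p z τ)
  have hnn : inner ℝ n (τ • n) = τ := by
    rw [inner_smul_right, real_inner_self_eq_norm_sq, h.norm_eq_one]; ring
  have e1 : inner ℝ n (p + τ • n - z) = -(inner ℝ n (z - p) - τ) := by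
    rw [add_sub_right_comm, inner_add_right, hnn, ← neg_sub z p, inner_neg_right]; ring
  have e2 : inner ℝ n (p - τ • n - z) = -(inner ℝ n (z - p) + τ) := by
    rw [sub_right_comm, inner_sub_right, hnn, ← neg_sub z p, inner_neg_right]; ring
  have e3 : -(m * inner ℝ n (p + τ • n - z)) / ‖p + τ • n - z‖ ^ (m + 2) -
      m * inner ℝ n (p - τ • n - z) / ‖p - τ • n - z‖ ^ (m + 2) =
      m * ((inner ℝ n (z - p) - τ) / ‖p + τ • n - z‖ ^ (m + 2) +
        (inner ℝ n (z - p) + τ) / ‖p - τ • n - z‖ ^ (m + 2)) := by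
    rw [e1, e2]; ring
  rw [e3, abs_mul, Nat.abs_cast, mul_assoc]
  gcongr

/-- The factor `4 ^ m` allows for replacing the reflected poles `p - t n` on the way from `p - d n`
to `p - τ n` by `p - d n`. -/
theorem HasTangentBalls.abs_potential_sub_le (hs : IsOpen s) (h : HasTangentBalls s p r n)
    (m : ℕ) {d : ℝ} (hd : 0 < d) (hdr : 3 * d ≤ r) (hτ : |τ - d| ≤ d / 2) (hz : z ∈ frontier s) :
    |(1 / ‖p + τ • n - z‖ ^ m - 1 / ‖p - τ • n - z‖ ^ m) -
      (1 / ‖p + d • n - z‖ ^ m - 1 / ‖p - d • n - z‖ ^ m)| ≤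
      m * ((2 ^ m + 1 + (m + 2) * 2 ^ (m + 4)) / r) * 4 ^ m * (1 / ‖p - d • n - z‖ ^ m) *
        |τ - d| := by
  have hr : 0 < r := by linarith
  have hmem : ∀ t ∈ uIcc d τ, d / 2 ≤ t ∧ t ≤ 3 / 2 * d := by
    intro t ht
    have := abs_le.1 ((abs_sub_left_of_mem_uIcc ht).trans hτ)
    constructor <;> linarith
  have hpos : ∀ t : ℝ, 0 < t → t < r → 0 < ‖p - t • n - z‖ := fun t ht htr =>
    norm_pos_iff.2 (sub_ne_zero.2 fun h0 =>
      h.sub_smul_notMem_closure ht htr (h0 ▸ frontier_subset_closure hz))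
  have hcmp : ∀ t ∈ uIcc d τ, 1 / ‖p - t • n - z‖ ^ m ≤ 4 ^ m * (1 / ‖p - d • n - z‖ ^ m) := by
    intro t ht
    obtain ⟨ht1, ht2⟩ := hmem t ht
    have b1 := hpos t (by linarith) (by linarith)
    have b2 := hpos d (by linarith) (by linarith)
    have i1 := (sq_le_of_reflected (by linarith) (by linarith)
      (h.abs_inner_le hs hr hz) (norm_add_smul_sub_sq h.norm_eq_one p z t)
      (norm_sub_smul_sub_sq h.norm_eq_one p z t)).2.1
    have i2 := (sq_le_of_reflected hd (by linarith)
      (h.abs_inner_le hs hr hz) (norm_add_smul_sub_sq h.norm_eq_one p z d)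
      (norm_sub_smul_sub_sq h.norm_eq_one p z d)).2.2.2
    have i3 : ‖p - d • n - z‖ ≤ 4 * ‖p - t • n - z‖ := by
      apply le_of_sq_le_sq _ (by positivity)
      nlinarith [sq_nonneg ‖z - p‖]
    rw [mul_one_div, div_le_div_iff₀ (by positivity) (by positivity), one_mul, ← mul_pow]
    gcongr
  choose! D hD hDle using fun t (ht : t ∈ uIcc d τ) =>
    h.abs_deriv_potential_sub_le (τ := t) hs m (by linarith [hmem t ht])
      (by linarith [hmem t ht]) hz
  have := (convex_uIcc d τ).norm_image_sub_le_of_norm_hasDerivWithin_le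
    (fun t ht => (hD t ht).hasDerivWithinAt)
    (C := m * ((2 ^ m + 1 + (m + 2) * 2 ^ (m + 4)) / r) * 4 ^ m * (1 / ‖p - d • n - z‖ ^ m))
    (fun t ht => ?_) left_mem_uIcc right_mem_uIcc
  · exact this
  · refine (hDle t ht).trans ?_
    rw [mul_assoc _ (4 ^ m)]
    gcongr
    exact hcmp t ht

end Comparison

/-! ### Dependence of harmonic functions on the pole of their boundary values -/

section Pole
variable {E : Type*} [NormedAddCommGroup E] [InnerProductSpace ℝ E] {s : Set E} {p n : E}
  {r τ : ℝ} [FiniteDimensional ℝ E]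

theorem InnerProductSpace.HarmonicContOnCl.abs_le_of_frontier [Nontrivial E] {u v : E → ℝ}
    (hu : HarmonicContOnCl u s) (hv : HarmonicContOnCl v s) (hb : Bornology.IsBounded s)
    (hfr : ∀ z ∈ frontier s, |u z| ≤ v z) {y : E} (hy : y ∈ s) : |u y| ≤ v y := by
  refine abs_le'.2 ⟨?_, ?_⟩
  · refine sub_nonpos.1 (HarmonicContOnCl.nonpos_of_frontier (hu.fun_sub hv) hb ?_ hy)
    exact fun z hz => sub_nonpos.2 (abs_le'.1 (hfr z hz)).1
  · refine sub_nonpos.1 (HarmonicContOnCl.nonpos_of_frontier (hu.fun_neg.fun_sub hv) hb ?_ hy)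
    exact fun z hz => sub_nonpos.2 (abs_le'.1 (hfr z hz)).2

theorem harmonicContOnCl_one_div_norm_pow {m : ℕ} (hm : Module.finrank ℝ E = m + 2) {a : E}
    (ha : a ∉ closure s) : HarmonicContOnCl (fun y => 1 / ‖a - y‖ ^ m) s :=
  HarmonicOnNhd.harmonicContOnCl fun _ hy =>
    harmonicAt_one_div_norm_pow hm (ne_of_mem_of_not_mem hy ha)

variable [Nontrivial E] {m : ℕ}

/-- The harmonic function with the boundary values of the potential of `p + τ n` is, up to a relative
error `O(τ)`, the potential of the reflected pole `p - τ n`. -/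
theorem HasTangentBalls.abs_sub_reflected_le (hm : Module.finrank ℝ E = m + 2) (hs : IsOpen s)
    (hb : Bornology.IsBounded s) (h : HasTangentBalls s p r n) (hτ : 0 < τ) (hτr : 2 * τ ≤ r)
    {c : ℝ} (hc : 0 ≤ c) {u : E → ℝ} (hu : HarmonicContOnCl u s)
    (hfr : ∀ z ∈ frontier s, u z = c * (1 / ‖p + τ • n - z‖ ^ m)) {y : E} (hy : y ∈ s) :
    |u y - c * (1 / ‖p - τ • n - y‖ ^ m)| ≤
      c * (m * 2 ^ (m + 1) / r * τ) * (1 / ‖p - τ • n - y‖ ^ m) := by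
  have hB := harmonicContOnCl_one_div_norm_pow hm
    (h.sub_smul_notMem_closure hτ (by linarith))
  refine HarmonicContOnCl.abs_le_of_frontier (hu.fun_sub (hB.fun_const_smul c))
    (hB.fun_const_smul _) hb (fun z hz => ?_) hy
  have h3 := abs_one_div_pow_sub_le m (norm_nonneg (p + τ • n - z)) (norm_nonneg (p - τ • n - z))
    hτ hτr (sq_nonneg _) (h.abs_inner_le hs (by linarith) hz)
    (norm_add_smul_sub_sq h.norm_eq_one p z τ) (norm_sub_smul_sub_sq h.norm_eq_one p z τ)
  rw [hfr z hz, smul_eq_mul, smul_eq_mul, ← mul_sub, abs_mul, abs_of_nonneg hc]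
  refine (mul_le_mul_of_nonneg_left h3 hc).trans_eq ?_
  ring

variable {c d : ℝ} {u : ℝ → E → ℝ}

/-- The bound for the normal derivative, stated for increments of the pole. -/
theorem HasTangentBalls.abs_increment_sub_reflected_le (hm : Module.finrank ℝ E = m + 2)
    (hs : IsOpen s) (hb : Bornology.IsBounded s) (h : HasTangentBalls s p r n) (hd : 0 < d)
    (hdr : 3 * d ≤ r) (hc : 0 ≤ c) (hu : ∀ t ∈ Ioo 0 r, HarmonicContOnCl (u t) s)
    (hfr : ∀ t ∈ Ioo 0 r, ∀ z ∈ frontier s, u t z = c * (1 / ‖p + t • n - z‖ ^ m))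
    (hτ : |τ - d| ≤ d / 2) {y : E} (hy : y ∈ s) :
    |(u τ y - c * (1 / ‖p - τ • n - y‖ ^ m)) - (u d y - c * (1 / ‖p - d • n - y‖ ^ m))| ≤
      c * (m * ((2 ^ m + 1 + (m + 2) * 2 ^ (m + 4)) / r) * 4 ^ m) *
        (1 / ‖p - d • n - y‖ ^ m) * |τ - d| := by
  have hτ' := abs_le.1 hτ
  have hτI : τ ∈ Ioo 0 r := ⟨by linarith, by linarith⟩
  have hdI : d ∈ Ioo 0 r := ⟨by linarith, by linarith⟩
  have hB : ∀ t ∈ Ioo 0 r, HarmonicContOnCl (fun y => 1 / ‖p - t • n - y‖ ^ m) s := fun t ht =>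
    harmonicContOnCl_one_div_norm_pow hm (h.sub_smul_notMem_closure ht.1 ht.2)
  rw [mul_right_comm]
  refine HarmonicContOnCl.abs_le_of_frontier
    (((hu τ hτI).fun_sub ((hB τ hτI).fun_const_smul c)).fun_sub
      ((hu d hdI).fun_sub ((hB d hdI).fun_const_smul c))) ((hB d hdI).fun_const_smul _) hb
    (fun z hz => ?_) hy
  have h3 := h.abs_potential_sub_le hs m hd hdr hτ hz
  rw [hfr τ hτI z hz, hfr d hdI z hz]
  simp only [smul_eq_mul]
  rw [← mul_sub, ← mul_sub, ← mul_sub, abs_mul, abs_of_nonneg hc]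
  refine (mul_le_mul_of_nonneg_left h3 hc).trans_eq ?_
  ring

/-- By the maximum principle the difference quotients in the pole are uniformly Cauchy, as they are
on the boundary. -/
theorem HasTangentBalls.differentiableAt_pole (hs : IsOpen s) (hb : Bornology.IsBounded s)
    (h : HasTangentBalls s p r n) (hd : 0 < d) (hdr : d < r)
    (hu : ∀ t ∈ Ioo 0 r, HarmonicContOnCl (u t) s)
    (hfr : ∀ t ∈ Ioo 0 r, ∀ z ∈ frontier s, u t z = c * (1 / ‖p + t • n - z‖ ^ m))
    {y : E} (hy : y ∈ s) : DifferentiableAt ℝ (fun t => u t y) d := by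
  have hcpt : IsCompact (frontier s) :=
    hb.isCompact_closure.of_isClosed_subset isClosed_frontier frontier_subset_closure
  have hdI : d ∈ Ioo 0 r := ⟨hd, hdr⟩
  obtain ⟨a, ha0, had⟩ := exists_between hd
  obtain ⟨b, hdb, hbr⟩ := exists_between hdr
  have hne : ∀ t ∈ Icc a b, ∀ z ∈ frontier s, p + t • n - z ≠ 0 := fun t ht z hz =>
    sub_ne_zero.2 fun h0 => (hs.frontier_eq ▸ hz).2
      (h0 ▸ h.add_smul_mem (ha0.trans_le ht.1) (ht.2.trans_lt hbr))
  have hψ : ContinuousOn (fun q : ℝ × E => c * (-(m * inner ℝ n (p + q.1 • n - q.2)) /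
      ‖p + q.1 • n - q.2‖ ^ (m + 2))) (Icc a b ×ˢ frontier s) := by
    refine continuousOn_const.mul (ContinuousOn.div (by fun_prop) (by fun_prop) ?_)
    rintro ⟨t, z⟩ ⟨ht, hz⟩
    exact pow_ne_zero _ (norm_ne_zero_iff.2 (hne t ht z hz))
  refine differentiableAt_of_slope_cauchy fun ε hε => ?_
  have hunif := eventually_abs_sub_sub_mul_le hcpt (d := d)
    (f := fun t z => c * (1 / ‖p + t • n - z‖ ^ m))
    (ψ := fun t z => c * (-(m * inner ℝ n (p + t • n - z)) / ‖p + t • n - z‖ ^ (m + 2)))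
    had hdb hψ (fun t ht z hz =>
      (hasDerivAt_one_div_norm_add_smul_sub_pow m (hne t ht z hz)).const_mul c) (half_pos hε)
  have hS : {t : ℝ | t ∈ Ioo 0 r ∧ t ≠ d ∧ ∀ z ∈ frontier s,
      |slope (fun t => u t z) d t -
        c * (-(m * inner ℝ n (p + d • n - z)) / ‖p + d • n - z‖ ^ (m + 2))| ≤ ε / 2}
      ∈ 𝓝[≠] d := by
    filter_upwards [mem_nhdsWithin_of_mem_nhds (Ioo_mem_nhds hd hdr),
      mem_nhdsWithin_of_mem_nhds hunif, self_mem_nhdsWithin] with t htI ht htd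
    refine ⟨htI, htd, fun z hz => ?_⟩
    have htd' : t - d ≠ 0 := sub_ne_zero.2 htd
    have h1 := ht z hz
    rw [← hfr t htI z hz, ← hfr d hdI z hz] at h1
    rw [slope_def_field, ← mul_le_mul_iff_left₀ (abs_pos.2 htd'), ← abs_mul]
    refine le_of_eq_of_le ?_ h1
    congr 1
    field_simp
  refine ⟨_, hS, ?_⟩
  rintro t ⟨htI, -, ht⟩ t' ⟨htI', -, ht'⟩
  have hslope : ∀ t ∈ Ioo 0 r, HarmonicContOnCl (fun z => slope (fun t => u t z) d t) s :=
    fun t htI => ((hu t htI).fun_sub (hu d hdI)).fun_const_smul (t - d)⁻¹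
  refine HarmonicContOnCl.abs_le_of_frontier (v := fun _ => ε)
    ((hslope t htI).fun_sub (hslope t' htI')) harmonicContOnCl_const hb (fun z hz => ?_) hy
  have := abs_sub_le_iff.1 (ht z hz)
  have := abs_sub_le_iff.1 (ht' z hz)
  exact abs_sub_le_iff.2 ⟨by linarith, by linarith⟩

end Pole

/-! ### The regular part of the Green's function -/

section RegularPart
variable {N : ℕ} {Ω : Set (EuclideanSpace ℝ (Fin N))}
  {G : EuclideanSpace ℝ (Fin N) → EuclideanSpace ℝ (Fin N) → ℝ} {x : EuclideanSpace ℝ (Fin N)}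

/-- On the diagonal this uses that the limit in `regularPart` exists, by continuity of the
corrector. -/
theorem regularPart_eq_corrector [Nontrivial (EuclideanSpace ℝ (Fin N))] (hopen : IsOpen Ω)
    (hx : x ∈ Ω) {h : EuclideanSpace ℝ (Fin N) → ℝ} (hh : IsCorrector Ω x h)
    (hG : ∀ y ∈ closure Ω, y ≠ x → G x y = fundSol (x - y) - h y)
    {y : EuclideanSpace ℝ (Fin N)} (hy : y ∈ Ω) : regularPart G x y = h y := by
  rw [regularPart]
  split_ifs with hyx
  · subst hyx
    have : (𝓝[≠] y).NeBot := Module.punctured_nhds_neBot ℝ _ y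
    apply Tendsto.limUnder_eq
    have hc : ContinuousAt h y := (hh.harmonic y hy).1.continuousAt
    refine (hc.tendsto.mono_left nhdsWithin_le_nhds).congr' ?_
    filter_upwards [mem_nhdsWithin_of_mem_nhds (hopen.mem_nhds hy), self_mem_nhdsWithin]
      with z hz hzy
    rw [hG z (subset_closure hz) hzy]; ring
  · rw [hG y (subset_closure hy) hyx]; ring

theorem fundSol_eq (z : EuclideanSpace ℝ (Fin N)) :
    fundSol z = 1 / (((N : ℝ) - 2) * sphereArea N) * (1 / ‖z‖ ^ (N - 2)) := by
  rw [fundSol, one_div_mul_one_div]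

/-- The expansions of `H` at a point of the normal through `p`, at distance `d` from the
boundary. -/
theorem IsGreenFunction.regularPart_expansion (hN : 3 ≤ N) (hopen : IsOpen Ω)
    (hbdd : Bornology.IsBounded Ω) (hG : IsGreenFunction Ω G) {p n : EuclideanSpace ℝ (Fin N)}
    {r d : ℝ} (h : HasTangentBalls Ω p r n) (hp : p ∈ frontier Ω) (hd : 0 < d) (hdr : 3 * d ≤ r)
    {y : EuclideanSpace ℝ (Fin N)} (hy : y ∈ Ω) :
    |regularPart G (p + d • n) y
        - 1 / (((N : ℝ) - 2) * sphereArea N) * (1 / ‖p - d • n - y‖ ^ (N - 2))|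
      ≤ 1 / (((N : ℝ) - 2) * sphereArea N) * (((N - 2 : ℕ) : ℝ) * 2 ^ (N - 2 + 1) / r * d) *
        (1 / ‖p - d • n - y‖ ^ (N - 2)) ∧
    LineDifferentiableAt ℝ (fun x' => regularPart G x' y) (p + d • n) n ∧
    LineDifferentiableAt ℝ (fun x' => 1 / ‖bdryReflection Ω x' - y‖ ^ (N - 2)) (p + d • n) n ∧
    |lineDeriv ℝ (fun x' => regularPart G x' y) (p + d • n) n
        - 1 / (((N : ℝ) - 2) * sphereArea N) *
          lineDeriv ℝ (fun x' => 1 / ‖bdryReflection Ω x' - y‖ ^ (N - 2)) (p + d • n) n|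
      ≤ 1 / (((N : ℝ) - 2) * sphereArea N) * (((N - 2 : ℕ) : ℝ) *
          ((2 ^ (N - 2) + 1 + (((N - 2 : ℕ) : ℝ) + 2) * 2 ^ (N - 2 + 4)) / r) * 4 ^ (N - 2)) *
        (1 / ‖p - d • n - y‖ ^ (N - 2)) := by
  have : Nonempty (Fin N) := ⟨⟨0, by omega⟩⟩
  have hm : Module.finrank ℝ (EuclideanSpace ℝ (Fin N)) = (N - 2) + 2 := by
    rw [finrank_euclideanSpace_fin]; omega
  have hc : 0 ≤ 1 / (((N : ℝ) - 2) * sphereArea N) := by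
    have : (3 : ℝ) ≤ N := by exact_mod_cast hN
    exact one_div_nonneg.2 (mul_nonneg (by linarith) measureReal_nonneg)
  set c := 1 / (((N : ℝ) - 2) * sphereArea N) with hc_def
  have hmem : ∀ t ∈ Ioo 0 r, p + t • n ∈ Ω := fun t ht => h.add_smul_mem ht.1 ht.2
  choose! k hk hGk using hG
  have hu : ∀ t ∈ Ioo 0 r, HarmonicContOnCl (k (p + t • n)) Ω := fun t ht =>
    ⟨(hk _ (hmem t ht)).harmonic, (hk _ (hmem t ht)).continuousOn⟩
  have hfr : ∀ t ∈ Ioo 0 r, ∀ z ∈ frontier Ω,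
      k (p + t • n) z = c * (1 / ‖p + t • n - z‖ ^ (N - 2)) := fun t ht z hz => by
    rw [(hk _ (hmem t ht)).boundary z hz, fundSol_eq]
  have hH : ∀ t ∈ Ioo 0 r, regularPart G (p + t • n) y = k (p + t • n) y := fun t ht =>
    regularPart_eq_corrector hopen (hmem t ht) (hk _ (hmem t ht)) (hGk _ (hmem t ht)) hy
  have hr : 0 < r := by linarith
  have hdI : d ∈ Ioo 0 r := ⟨hd, by linarith⟩
  have hnhds : Ioo 0 r ∈ 𝓝 d := Ioo_mem_nhds hdI.1 hdI.2
  have hdiff := h.differentiableAt_pole (u := fun t => k (p + t • n)) hopen hbdd hd hdI.2 hu hfr hy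
  have hHd : HasDerivAt (fun t : ℝ => regularPart G (p + t • n) y)
      (deriv (fun t : ℝ => k (p + t • n) y) d) d :=
    hdiff.hasDerivAt.congr_of_eventuallyEq (mem_of_superset hnhds hH)
  have hne : p - d • n - y ≠ 0 := sub_ne_zero.2 fun h0 =>
    h.sub_smul_notMem_closure hd hdI.2 (h0 ▸ subset_closure hy)
  have hBd := hasDerivAt_one_div_norm_sub_smul_sub_pow (N - 2) hne
  have hR : (fun t : ℝ => 1 / ‖bdryReflection Ω (p + t • n) - y‖ ^ (N - 2)) =ᶠ[𝓝 d]
      fun t => 1 / ‖p - t • n - y‖ ^ (N - 2) := by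
    filter_upwards [hnhds] with t ht
    rw [h.bdryReflection_eq hopen hp ht.1 ht.2]
  have hRd := hBd.congr_of_eventuallyEq hR
  -- The line through `p + d n` with direction `n` is the normal at `p`, shifted by `d`.
  have hline : ∀ {f : EuclideanSpace ℝ (Fin N) → ℝ} {f' : ℝ},
      HasDerivAt (fun t : ℝ => f (p + t • n)) f' d → HasLineDerivAt ℝ f f' (p + d • n) n := by
    intro f f' hf
    have h1 : HasDerivAt (fun t : ℝ => f (p + (d + t) • n)) f' 0 :=
      HasDerivAt.comp_const_add d 0 (f := fun t : ℝ => f (p + t • n)) (by simpa using hf)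
    simpa only [HasLineDerivAt, add_smul, add_assoc] using h1
  refine ⟨?_, (hline hHd).lineDifferentiableAt,
    (hline (f := fun x' => 1 / ‖bdryReflection Ω x' - y‖ ^ (N - 2)) hRd).lineDifferentiableAt, ?_⟩
  · rw [hH d hdI]
    exact h.abs_sub_reflected_le hm hopen hbdd hd (by linarith) hc (hu d hdI) (hfr d hdI) hy
  · rw [(hline hHd).lineDeriv,
      (hline (f := fun x' => 1 / ‖bdryReflection Ω x' - y‖ ^ (N - 2)) hRd).lineDeriv]
    refine (hdiff.hasDerivAt.fun_sub (hBd.const_mul c)).le_of_lip' (by positivity) ?_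
    filter_upwards [Metric.closedBall_mem_nhds d (half_pos hd)] with t ht
    exact h.abs_increment_sub_reflected_le (u := fun t => k (p + t • n)) hm hopen hbdd hd hdr hc
      hu hfr ht hy

end RegularPart

theorem lemmaA1 (N : ℕ) (hN : 3 ≤ N) (Ω : Set (EuclideanSpace ℝ (Fin N)))
    (hopen : IsOpen Ω) (hconn : IsConnected Ω) (hbdd : Bornology.IsBounded Ω)
    (hC2 : HasC2Boundary Ω) :
    ∃ δ : ℝ, 0 < δ ∧
      -- the projection is well defined in the layer, and reflected points leave `Ω`
      (∀ x ∈ Ω, bdryDist Ω x < δ →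
        (∃! p, IsNearestBdryPt Ω x p) ∧ bdryReflection Ω x ∉ Ω) ∧
      ∃ C : ℝ, 0 < C ∧
        ∀ G : EuclideanSpace ℝ (Fin N) → EuclideanSpace ℝ (Fin N) → ℝ, IsGreenFunction Ω G →
          ∀ x ∈ Ω, bdryDist Ω x < δ → ∀ y ∈ Ω,
            -- expansion of `H`
            |regularPart G x y
                - 1 / (((N : ℝ) - 2) * sphereArea N * ‖bdryReflection Ω x - y‖ ^ (N - 2))|
              ≤ C * (bdryDist Ω x / ‖bdryReflection Ω x - y‖ ^ (N - 2)) ∧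
            -- both normal derivatives exist, and the expansion of `∂H/∂ν_x`
            LineDifferentiableAt ℝ (fun x' => regularPart G x' y) x (inwardNormal Ω x) ∧
            LineDifferentiableAt ℝ (fun x' => 1 / ‖bdryReflection Ω x' - y‖ ^ (N - 2)) x
              (inwardNormal Ω x) ∧
            |lineDeriv ℝ (fun x' => regularPart G x' y) x (inwardNormal Ω x)
                - 1 / (((N : ℝ) - 2) * sphereArea N) *
                  lineDeriv ℝ (fun x' => 1 / ‖bdryReflection Ω x' - y‖ ^ (N - 2)) x
                    (inwardNormal Ω x)|
              ≤ C * (1 / ‖bdryReflection Ω x - y‖ ^ (N - 2)) := by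
  have : Nonempty (Fin N) := ⟨⟨0, by omega⟩⟩
  have hc : 0 ≤ 1 / (((N : ℝ) - 2) * sphereArea N) := by
    have : (3 : ℝ) ≤ N := by exact_mod_cast hN
    exact one_div_nonneg.2 (mul_nonneg (by linarith) measureReal_nonneg)
  have hfne : (frontier Ω).Nonempty := by
    refine nonempty_frontier_iff.2 ⟨hconn.nonempty, ?_⟩
    rintro rfl
    exact NormedSpace.unbounded_univ ℝ (EuclideanSpace ℝ (Fin N)) hbdd
  obtain ⟨r, hr, hballs⟩ := hC2.exists_hasTangentBalls hopen hbdd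
  have hrep : ∀ x ∈ Ω, bdryDist Ω x < r / 3 → ∃ p ∈ frontier Ω, ∃ n, HasTangentBalls Ω p r n ∧
      0 < bdryDist Ω x ∧ x = p + bdryDist Ω x • n := by
    intro x hx hxd
    obtain ⟨p, hp, hxp⟩ := isClosed_frontier.exists_infDist_eq_dist hfne x
    obtain ⟨n, hn⟩ := hballs p hp
    refine ⟨p, hp, n, hn, ?_, hn.sub_eq_smul hopen hr hx hp hxp.symm⟩
    rw [bdryDist, hxp, dist_pos]
    rintro rfl
    exact (hopen.frontier_eq ▸ hp).2 hx
  refine ⟨r / 3, by positivity, fun x hx hxd => ?_, ?_⟩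
  · obtain ⟨p, hp, n, hn, hd, hxe⟩ := hrep x hx hxd
    set d := bdryDist Ω x
    have hdr : d < r := by linarith
    rw [hxe, hn.bdryReflection_eq hopen hp hd hdr]
    exact ⟨⟨p, (hn.isNearestBdryPt_iff hopen hp hd hdr p).2 rfl, fun q hq =>
      (hn.isNearestBdryPt_iff hopen hp hd hdr q).1 hq⟩,
      fun hm => hn.sub_smul_notMem_closure hd hdr (subset_closure hm)⟩
  · set c₁ := 1 / (((N : ℝ) - 2) * sphereArea N) * (((N - 2 : ℕ) : ℝ) * 2 ^ (N - 2 + 1) / r)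
      with hc₁
    set c₂ := 1 / (((N : ℝ) - 2) * sphereArea N) * (((N - 2 : ℕ) : ℝ) *
      ((2 ^ (N - 2) + 1 + (((N - 2 : ℕ) : ℝ) + 2) * 2 ^ (N - 2 + 4)) / r) * 4 ^ (N - 2)) with hc₂
    have hc₁0 : 0 ≤ c₁ := by positivity
    have hc₂0 : 0 ≤ c₂ := by positivity
    refine ⟨c₁ + c₂ + 1, by positivity, fun G hG x hx hxd y hy => ?_⟩
    obtain ⟨p, hp, n, hn, hd, hxe⟩ := hrep x hx hxd
    obtain ⟨h1, h2, h3, h4⟩ := hG.regularPart_expansion hN hopen hbdd hn hp hd (by linarith) hy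
    rw [← hc₂] at h4
    rw [← mul_assoc, ← hc₁, one_div_mul_one_div] at h1
    generalize bdryDist Ω x = d at *
    have hdr : d < r := by linarith
    subst hxe
    rw [hn.bdryReflection_eq hopen hp hd hdr, hn.inwardNormal_eq hopen hp hd hdr]
    refine ⟨h1.trans ?_, h2, h3, h4.trans ?_⟩
    · rw [mul_assoc, mul_one_div]
      gcongr
      linarith
    · gcongr
      linarith
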